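/- All graphs are finite and simple; $C_k$ ($k\ge 3$) denotes the cycle of length $k$, and cycles are considered up to isomorphism. For a nonnegative integer $D$, a graph is $(D,D)$-colorable if its vertex set can be partitioned into two (possibly empty) parts, each inducing a subgraph of maximum degree at most $D$. A set $S$ of cycles is called a cycle obstruction set of balanced $2$-partitionable planar graphs if there is a nonnegative integer $D$ such that every planar graph containing no member of $S$ as a (not necessarily induced) subgraph is $(D,D)$-colorable. Theorem. Let $S$ be a set of cycles. Then $S$ is a cycle obstruction set of balanced $2$-partitionable planar graphs if and only if $C_4\in S$ or $S$ contains all odd cycles. Consequently, the inclusion-wise minimal cycle obstruction sets of balanced $2$-partitionable planar graphs are exactly $\{C_4\}$ and $\{C_{2i+1} : i\ge 1\}$. -/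

import Mathlib

namespace ImproperColoring

/-- The Euclidean plane; only its affine structure is used below. -/
abbrev Plane : Type := ℝ × ℝ

/-- `A` is a simple polygonal arc from `x` to `y`: the union of the segments
`[q 0, q 1], [q 1, q 2], …, [q n, q (n + 1)]`, all of positive length, where `q 0 = x`,
`q (n + 1) = y`, consecutive segments meet only in their common endpoint, and non-consecutive
segments are disjoint. -/
def IsPolygonalArc (A : Set Plane) (x y : Plane) : Prop :=
  ∃ (n : ℕ) (q : ℕ → Plane),
    q 0 = x ∧ q (n + 1) = y ∧
    A = ⋃ i ∈ Set.Iic n, segment ℝ (q i) (q (i + 1)) ∧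
    (∀ i ≤ n, q i ≠ q (i + 1)) ∧
    (∀ i < n, segment ℝ (q i) (q (i + 1)) ∩ segment ℝ (q (i + 1)) (q (i + 2)) = {q (i + 1)}) ∧
    (∀ i j, i + 1 < j → j ≤ n →
      Disjoint (segment ℝ (q i) (q (i + 1))) (segment ℝ (q j) (q (j + 1))))

/-- An embedding of the graph `G` in the plane: distinct vertices are distinct points, each edge
is an arc joining its two ends, and the interior of an edge (the arc without its two ends)
contains no vertex and no point of any other edge. -/
structure PlaneEmbedding {V : Type} (G : SimpleGraph V) where
  point : V → Plane
  point_injective : Function.Injective point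
  arc : Sym2 V → Set Plane
  isPolygonalArc : ∀ u v, G.Adj u v → IsPolygonalArc (arc s(u, v)) (point u) (point v)
  interior_disjoint_vertices : ∀ e ∈ G.edgeSet,
    Disjoint (arc e \ point '' {w | w ∈ e}) (Set.range point)
  interior_disjoint_edges : ∀ e ∈ G.edgeSet, ∀ f ∈ G.edgeSet, e ≠ f →
    Disjoint (arc e \ point '' {w | w ∈ e}) (arc f)

/-- A graph is planar if it can be embedded in the plane. -/
def IsPlanar {V : Type} (G : SimpleGraph V) : Prop :=
  Nonempty (PlaneEmbedding G)

/-- `G` is `(d 0, …, d (k - 1))`-colorable: the vertices can be partitioned into `k` (possibly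
empty) color classes such that the `i`-th class induces a graph of maximum degree at most `d i`. -/
def IsDefectiveColorable {V : Type} [Finite V] (G : SimpleGraph V) {k : ℕ} (d : Fin k → ℕ) :
    Prop :=
  ∃ c : V → Fin k, ∀ (i : Fin k) (v : {v | c v = i}),
    ((G.induce {v | c v = i}).neighborSet v).ncard ≤ d i

/-- A class of finite simple graphs. -/
abbrev GraphClass : Type 1 :=
  ∀ (V : Type) [Finite V], SimpleGraph V → Prop

/-- A class of graphs is balanced `k`-partitionable if there is a single `D` such that all its
members are `(D, …, D)`-colorable, where the tuple has length `k`. -/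
def IsBalancedPartitionable (k : ℕ) (C : GraphClass) : Prop :=
  ∃ D : ℕ, ∀ (V : Type) [Finite V] (G : SimpleGraph V),
    C V G → IsDefectiveColorable G (fun _ : Fin k => D)

/-- Cycles up to isomorphism: the number `k ≥ 3` stands for the cycle `C_k` of length `k`. -/
abbrev CycleLength : Type := {k : ℕ // 3 ≤ k}

/-- The class of planar graphs that contain no cycle in `S` as a (not necessarily induced)
subgraph. -/
def planarAvoiding (S : Set CycleLength) : GraphClass :=
  fun _ _ G => IsPlanar G ∧ ∀ k ∈ S, ¬ (SimpleGraph.cycleGraph k.1).IsContained G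

/-- `S` is a cycle obstruction set of balanced `k`-partitionable planar graphs: the planar graphs
that contain no cycle in `S` form a balanced `k`-partitionable class. -/
def IsBalancedObstructionSet (k : ℕ) (S : Set CycleLength) : Prop :=
  IsBalancedPartitionable k (planarAvoiding S)

/-- The cycle `C_4`. -/
def fourCycle : CycleLength := ⟨4, by norm_num⟩

/-- The set of all odd cycles. -/
def oddCycles : Set CycleLength := {k | Odd k.1}

end ImproperColoring

/-!
Suppose that a planar graph has no four-cycle. A vertex with a single neighbor can always be
recolored to differ from that neighbor, and an edge both of whose ends have degree at most `D` can
be ignored if every vertex may have `D` neighbors of its own color. If a graph `G` admits neither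
reduction, then its vertices of degree at most `D` form an independent set `A`, and each of them has
two neighbors in the set `B` of the remaining vertices. Joining two such neighbors through each
vertex of `A` gives a planar graph on `B`, in which the edges coming from different vertices of `A`
are different because there is no four-cycle. As planar graphs have bounded average degree, `A` has
at most a constant times as many vertices as `B`, and then, for large `D`, the vertices of `B`
cannot all have degree more than `D`.

The only property of planar graphs used here is the bound on their average degree, and it is derived
from a consequence of planarity that survives deletions, contractions and the suppression of
vertices: any two edges without a common end cross an even number of times. Both this parity and
its additivity along polygonal lines are algebraic identities modulo two, and the complete graph
on five vertices violates it. A constant bound on the average degree then follows by contracting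
edges: if an edge has few common neighbors, its contraction reduces to a smaller graph, and
otherwise the neighborhood of a vertex is dense and the same argument applies to it, with one more
vertex adjacent to everything.

Graphs without odd cycles are bipartite. Conversely, for a set that omits `C_4` and `C_(2 * r + 1)`,
take `D + 1` strands, each a path of `r` steps from a common root in which consecutive beads are
joined by `2 * D + 1` paths of length two, and join the root to the end of each strand. All cycles
have length `4` or `2 * r + 1`. In a coloring of defect `D` with two colors, consecutive beads have
the same color, so that the root has its own color on `D + 1` neighbors.
-/

namespace ImproperColoring

/-! ### Parity drawings -/

section ParityDrawing

variable {V W X : Type*}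

/-- The combinatorial shadow of a straight-line configuration of points in the plane: `left a b`
records whether the point `a` is to the left of the point `b`, and `above a b x` whether the
point `x` lies above the segment from `a` to `b`. Both are recorded modulo two. -/
structure ParityDrawing (X : Type*) where
  left : X → X → ZMod 2
  above : X → X → X → ZMod 2
  left_add_left : ∀ {a b : X}, a ≠ b → left a b + left b a = 1

namespace ParityDrawing

/-- The number modulo two of crossings of the segments `ab` and `cd`. The vertical distance
between the two segments is defined over the common part of their shadows on the horizontal axis,
and the formula compares its signs at the two ends of that part. -/
def crossing (D : ParityDrawing X) (a b c d : X) : ZMod 2 :=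
  D.above a b c + D.above a b d + D.above c d a + D.above c d b +
    D.left a c + D.left a d + D.left b c + D.left b d

theorem crossing_comm (D : ParityDrawing X) {a b c d : X} (hac : a ≠ c) (had : a ≠ d)
    (hbc : b ≠ c) (hbd : b ≠ d) : D.crossing c d a b = D.crossing a b c d := by
  have two : (2 : ZMod 2) = 0 := rfl
  rw [crossing, crossing]
  linear_combination D.left_add_left hac + D.left_add_left had + D.left_add_left hbc +
    D.left_add_left hbd + (2 - D.left a c - D.left a d - D.left b c - D.left b d) * two

/-- The number modulo two of segments of the polygonal line `w 0, …, w n` that lie below `x`. -/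
def aboveAlong (D : ParityDrawing X) (w : ℕ → X) (n : ℕ) (x : X) : ZMod 2 :=
  ∑ k ∈ Finset.range n, D.above (w k) (w (k + 1)) x

/-- The number modulo two of vertices of the triangle `abc` that lie above the opposite side. -/
def triangle (D : ParityDrawing X) (a b c : X) : ZMod 2 :=
  D.above a b c + D.above a c b + D.above b c a

theorem crossing_add_crossing_add_crossing (D : ParityDrawing X) (a : X) {b c d : X} (hbc : b ≠ c)
    (hbd : b ≠ d) (hcd : c ≠ d) :
    D.crossing a b c d + D.crossing a c b d + D.crossing a d b c =
      1 + (D.triangle a b c + D.triangle a b d + D.triangle a c d + D.triangle b c d) := by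
  have two : (2 : ZMod 2) = 0 := rfl
  simp only [crossing, triangle]
  linear_combination D.left_add_left hbc + D.left_add_left hbd + D.left_add_left hcd +
    (D.left a b + D.left a c + D.left a d + 1) * two

theorem sum_range_add_succ {R : Type*} [Ring R] [CharP R 2] (f : ℕ → R) (n : ℕ) :
    ∑ k ∈ Finset.range n, (f k + f (k + 1)) = f 0 + f n := by
  simpa only [CharTwo.sub_eq_add, add_comm] using Finset.sum_range_sub f n

theorem sum_crossing (D : ParityDrawing X) (a b : X) (u : ℕ → X) (n : ℕ) :
    ∑ l ∈ Finset.range n, D.crossing a b (u l) (u (l + 1)) =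
      D.above a b (u 0) + D.above a b (u n) + D.aboveAlong u n a + D.aboveAlong u n b +
        (D.left a (u 0) + D.left a (u n)) + (D.left b (u 0) + D.left b (u n)) := by
  have telescope_above := sum_range_add_succ (fun l => D.above a b (u l)) n
  have telescope_left (x : X) := sum_range_add_succ (fun l => D.left x (u l)) n
  simp only [crossing, aboveAlong, Finset.sum_add_distrib] at *
  linear_combination telescope_above + telescope_left a + telescope_left b

theorem sum_sum_crossing (D : ParityDrawing X) (w u : ℕ → X) (m n : ℕ) :
    ∑ k ∈ Finset.range m, ∑ l ∈ Finset.range n, D.crossing (w k) (w (k + 1)) (u l) (u (l + 1)) =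
      D.aboveAlong w m (u 0) + D.aboveAlong w m (u n) +
        D.aboveAlong u n (w 0) + D.aboveAlong u n (w m) +
        D.left (w 0) (u 0) + D.left (w 0) (u n) + D.left (w m) (u 0) + D.left (w m) (u n) := by
  have telescope_above := sum_range_add_succ (fun k => D.aboveAlong u n (w k)) m
  have telescope_left (x : X) := sum_range_add_succ (fun k => D.left (w k) x) m
  simp only [sum_crossing, aboveAlong, Finset.sum_add_distrib] at *
  linear_combination telescope_above + telescope_left (u 0) + telescope_left (u n)

end ParityDrawing

/-- A graph is independently even if its vertices can be placed and its edges drawn in the plane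
so that any two edges without a common end cross an even number of times; only the parities of
such a drawing are kept. Unlike planarity, this property has an algebraic certificate, and it is
all that the proof uses of planarity. -/
def IndependentlyEven (G : SimpleGraph V) : Prop :=
  ∃ D : ParityDrawing V, ∀ ⦃a b c d : V⦄, G.Adj a b → G.Adj c d →
    a ≠ c → a ≠ d → b ≠ c → b ≠ d → D.crossing a b c d = 0

theorem independentlyEven_of_paths {K : SimpleGraph W} (D : ParityDrawing X) {φ : W → X}
    (hφ : Function.Injective φ) (path : W → W → ℕ → X) (len : W → W → ℕ)
    (path_zero : ∀ ⦃a b⦄, K.Adj a b → path a b 0 = φ a)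
    (path_len : ∀ ⦃a b⦄, K.Adj a b → path a b (len a b) = φ b)
    (crossing_eq_zero : ∀ ⦃a b c d⦄, K.Adj a b → K.Adj c d → a ≠ c → a ≠ d → b ≠ c → b ≠ d →
      ∀ k < len a b, ∀ l < len c d,
        D.crossing (path a b k) (path a b (k + 1)) (path c d l) (path c d (l + 1)) = 0) :
    IndependentlyEven K := by
  refine ⟨⟨fun a b => D.left (φ a) (φ b),
    fun a b x => D.aboveAlong (path a b) (len a b) (φ x),
    fun hab => D.left_add_left (hφ.ne hab)⟩, fun a b c d hab hcd hac had hbc hbd => ?_⟩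
  have total := D.sum_sum_crossing (path a b) (path c d) (len a b) (len c d)
  rw [Finset.sum_eq_zero fun k hk => Finset.sum_eq_zero fun l hl =>
    crossing_eq_zero hab hcd hac had hbc hbd k (Finset.mem_range.1 hk) l (Finset.mem_range.1 hl),
    path_zero hab, path_zero hcd, path_len hab, path_len hcd] at total
  exact total.symm

theorem IndependentlyEven.of_walks {G : SimpleGraph V} (hG : IndependentlyEven G)
    {K : SimpleGraph W} {φ : W → V} (hφ : Function.Injective φ) (S : W → W → Set V)
    (exists_walk : ∀ ⦃a b⦄, K.Adj a b → ∃ p : G.Walk (φ a) (φ b), ∀ v ∈ p.support, v ∈ S a b)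
    (disjoint : ∀ ⦃a b c d⦄, K.Adj a b → K.Adj c d → a ≠ c → a ≠ d → b ≠ c → b ≠ d →
      Disjoint (S a b) (S c d)) :
    IndependentlyEven K := by
  obtain ⟨D, hD⟩ := hG
  have exists_path (a b : W) : ∃ (w : ℕ → V) (n : ℕ), K.Adj a b →
      w 0 = φ a ∧ w n = φ b ∧ (∀ k < n, G.Adj (w k) (w (k + 1))) ∧ ∀ k, w k ∈ S a b := by
    by_cases hab : K.Adj a b
    · obtain ⟨p, hp⟩ := exists_walk hab
      exact ⟨p.getVert, p.length, fun _ => ⟨p.getVert_zero, p.getVert_length,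
        fun k hk => p.adj_getVert_succ hk, fun k => hp _ (p.getVert_mem_support k)⟩⟩
    · exact ⟨fun _ => φ a, 0, fun h => absurd h hab⟩
  choose w n hw using exists_path
  refine independentlyEven_of_paths D hφ w n (fun a b hab => (hw a b hab).1)
    (fun a b hab => (hw a b hab).2.1) fun a b c d hab hcd hac had hbc hbd k hk l hl => ?_
  obtain ⟨-, -, adj_ab, mem_ab⟩ := hw a b hab
  obtain ⟨-, -, adj_cd, mem_cd⟩ := hw c d hcd
  have apart (k l : ℕ) : w a b k ≠ w c d l :=
    (disjoint hab hcd hac had hbc hbd).ne_of_mem (mem_ab k) (mem_cd l)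
  exact hD (adj_ab k hk) (adj_cd l hl) (apart _ _) (apart _ _) (apart _ _) (apart _ _)

theorem IndependentlyEven.mono {G K : SimpleGraph V} (hG : IndependentlyEven G) (hle : K ≤ G) :
    IndependentlyEven K :=
  hG.imp fun _ hD _ _ _ _ hab hcd => hD (hle hab) (hle hcd)

theorem not_independentlyEven_top_five : ¬ IndependentlyEven (⊤ : SimpleGraph (Fin 5)) := by
  rintro ⟨D, hD⟩
  have even_four (a b c d : Fin 5) (hab : a < b) (hbc : b < c) (hcd : c < d) :
      1 + (D.triangle a b c + D.triangle a b d + D.triangle a c d + D.triangle b c d) = 0 := by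
    have hac := hab.trans hbc
    have hbd := hbc.trans hcd
    have had := hab.trans hbd
    rw [← D.crossing_add_crossing_add_crossing a hbc.ne hbd.ne hcd.ne,
      hD hab.ne hcd.ne hac.ne had.ne hbc.ne hbd.ne,
      hD hac.ne hbd.ne hab.ne had.ne hbc.ne' hcd.ne,
      hD had.ne hbc.ne hab.ne hac.ne hbd.ne' hcd.ne', add_zero, add_zero]
  -- Each of the ten triangles lies in two of the five quadruples, so that the sum is `5 = 0`.
  have h0123 := even_four 0 1 2 3 (by decide) (by decide) (by decide)
  have h0124 := even_four 0 1 2 4 (by decide) (by decide) (by decide)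
  have h0134 := even_four 0 1 3 4 (by decide) (by decide) (by decide)
  have h0234 := even_four 0 2 3 4 (by decide) (by decide) (by decide)
  have h1234 := even_four 1 2 3 4 (by decide) (by decide) (by decide)
  grind

end ParityDrawing

/-! ### Planar graphs are independently even -/

section PlaneDrawing

variable {a b c d p : Plane}

/-- Twice the signed area of the triangle `abc`; it is positive when the triangle is traversed
counterclockwise. -/
def orient (a b c : Plane) : ℝ :=
  (b.1 - a.1) * (c.2 - a.2) - (b.2 - a.2) * (c.1 - a.1)

theorem mem_segment_of_orient_eq_zero (hap : toLex a < toLex p) (hpb : toLex p < toLex b)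
    (h : orient a b p = 0) : p ∈ segment ℝ a b := by
  rw [segment_eq_image_lineMap]
  rw [Prod.Lex.toLex_lt_toLex] at hap hpb
  unfold orient at h
  rcases eq_or_lt_of_le (show a.1 ≤ b.1 by grind) with hab | hab
  · have ap : a.1 = p.1 := by grind
    have pos : 0 < b.2 - a.2 := by grind
    refine ⟨(p.2 - a.2) / (b.2 - a.2), ⟨by apply div_nonneg <;> grind,
      (div_le_one pos).2 (by grind)⟩, Prod.ext ?_ ?_⟩
    · simp [AffineMap.lineMap_apply, ← hab, ap]
    · simp [AffineMap.lineMap_apply, pos.ne']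
  · have pos : 0 < b.1 - a.1 := sub_pos.2 hab
    refine ⟨(p.1 - a.1) / (b.1 - a.1), ⟨by apply div_nonneg <;> grind,
      (div_le_one pos).2 (by grind)⟩, Prod.ext ?_ ?_⟩
    · simp [AffineMap.lineMap_apply, pos.ne']
    · simp only [AffineMap.lineMap_apply, vsub_eq_sub, vadd_eq_add, Prod.snd_add, Prod.smul_snd,
        Prod.snd_sub, smul_eq_mul]
      field_simp
      linarith

theorem div_sub_mem_Icc {s t : ℝ} (h : s * t < 0) : s / (s - t) ∈ Set.Icc 0 1 := by
  rcases mul_neg_iff.1 h with ⟨hs, ht⟩ | ⟨hs, ht⟩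
  · exact ⟨div_nonneg hs.le (by linarith), (div_le_one (by linarith)).2 (by linarith)⟩
  · exact ⟨div_nonneg_of_nonpos hs.le (by linarith),
      (div_le_one_of_neg (by linarith)).2 (by linarith)⟩

theorem not_disjoint_segment (hcd : orient a b c * orient a b d < 0)
    (hab : orient c d a * orient c d b < 0) : ¬ Disjoint (segment ℝ a b) (segment ℝ c d) := by
  rw [segment_eq_image_lineMap, segment_eq_image_lineMap]
  refine Set.not_disjoint_iff.2 ⟨_, ⟨_, div_sub_mem_Icc hab, rfl⟩, _, div_sub_mem_Icc hcd, ?_⟩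
  have ne : orient a b c - orient a b d ≠ 0 := fun h =>
    hcd.not_ge (sub_eq_zero.1 h ▸ mul_self_nonneg _)
  have eq_neg : orient c d a - orient c d b = -(orient a b c - orient a b d) := by
    unfold orient; ring
  rw [eq_neg]
  generalize hD : orient a b c - orient a b d = D at ne
  ext
  all_goals
    simp only [AffineMap.lineMap_apply, vsub_eq_sub, vadd_eq_add, Prod.fst_add, Prod.smul_fst,
      Prod.fst_sub, Prod.snd_add, Prod.smul_snd, Prod.snd_sub, smul_eq_mul]
    field_simp
    rw [← hD]
    unfold orient
    ring

theorem toLex_smul_pos {t : ℝ} {u : Plane} (ht : 0 < t) (hu : 0 < toLex u) :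
    0 < toLex (t • u) := by
  rw [← toLex_zero, Prod.Lex.toLex_lt_toLex] at *
  simpa [ht, ht.ne', eq_comm] using hu

theorem pos_of_toLex_smul_pos {t : ℝ} {u : Plane} (hu : 0 < toLex u) (h : 0 < toLex (t • u)) :
    0 < t := by
  by_contra! ht
  rcases ht.eq_or_lt with rfl | ht
  · simp at h
  · exact h.asymm (by simpa using toLex_smul_pos (neg_pos.2 ht) hu)

theorem pos_of_smul_sub_eq {a b c d e f : Plane} {r s t : ℝ} (hab : toLex a < toLex b)
    (hcd : toLex c < toLex d) (hef : toLex e < toLex f) (hr : 0 < r) (hs : 0 < s)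
    (h : t • (b - a) = r • (d - c) + s • (f - e)) : 0 < t := by
  have sub_toLex_pos {x y : Plane} (hxy : toLex x < toLex y) : 0 < toLex (y - x) :=
    sub_pos.2 hxy
  refine pos_of_toLex_smul_pos (sub_toLex_pos hab) ?_
  rw [h, toLex_add]
  exact add_pos (toLex_smul_pos hr (sub_toLex_pos hcd)) (toLex_smul_pos hs (sub_toLex_pos hef))

theorem orient_pos_iff_of_interlaced (hac : toLex a < toLex c) (hcb : toLex c < toLex b)
    (hbd : toLex b < toLex d) (h : Disjoint (segment ℝ a b) (segment ℝ c d)) :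
    0 < orient a b c ↔ ¬ 0 < orient c d b := by
  have ne_c : orient a b c ≠ 0 := fun h0 => h.ne_of_mem
    (mem_segment_of_orient_eq_zero hac hcb h0) (left_mem_segment ℝ c d) rfl
  have ne_b : orient c d b ≠ 0 := fun h0 => h.ne_of_mem (right_mem_segment ℝ a b)
    (mem_segment_of_orient_eq_zero hcb hbd h0) rfl
  by_contra hiff
  have same_sign : 0 < orient a b c * orient c d b := by
    rw [mul_pos_iff]; grind
  have opposite_d : 0 < -(orient a b c * orient a b d) :=
    pos_of_smul_sub_eq hcb (hac.trans hcb) hbd same_sign (mul_self_pos.2 ne_c) (by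
      ext <;> simp [orient] <;> ring)
  have opposite_a : 0 < -(orient c d a * orient c d b) :=
    pos_of_smul_sub_eq hcb hac (hcb.trans hbd) (mul_self_pos.2 ne_b) same_sign (by
      ext <;> simp [orient] <;> ring)
  exact not_disjoint_segment (neg_pos.1 opposite_d) (neg_pos.1 opposite_a) h

theorem orient_pos_iff_of_nested (hac : toLex a < toLex c) (hcd : toLex c ≤ toLex d)
    (hdb : toLex d < toLex b) (h : Disjoint (segment ℝ a b) (segment ℝ c d)) :
    0 < orient a b c ↔ 0 < orient a b d := by
  have had := hac.trans_le hcd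
  have hcb := hcd.trans_lt hdb
  have ne_c : orient a b c ≠ 0 := fun h0 => h.ne_of_mem
    (mem_segment_of_orient_eq_zero hac hcb h0) (left_mem_segment ℝ c d) rfl
  have ne_d : orient a b d ≠ 0 := fun h0 => h.ne_of_mem
    (mem_segment_of_orient_eq_zero had hdb h0) (right_mem_segment ℝ c d) rfl
  by_contra hiff
  have opposite : 0 < -(orient a b c * orient a b d) := by
    rw [neg_pos, mul_neg_iff]; grind
  have sign_b : 0 < -(orient a b d * orient c d b) :=
    pos_of_smul_sub_eq (hac.trans hcb) hcb hdb (mul_self_pos.2 ne_d) opposite (by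
      ext <;> simp [orient] <;> ring)
  have sign_a : 0 < orient a b d * orient c d a :=
    pos_of_smul_sub_eq (hac.trans hcb) hac had (mul_self_pos.2 ne_d) opposite (by
      ext <;> simp [orient] <;> ring)
  refine not_disjoint_segment (neg_pos.1 opposite) ?_ h
  have := mul_pos sign_a sign_b
  rw [mul_neg, neg_pos, mul_mul_mul_comm] at this
  exact (pos_iff_neg_of_mul_neg this).1 (mul_self_pos.2 ne_d)

open Classical in
/-- The parity drawing of the points of the plane. Points on a common vertical line are compared
by their heights, as if the plane were sheared by an infinitesimal angle. -/
noncomputable def planeDrawing : ParityDrawing Plane where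
  left a b := if toLex a < toLex b then 1 else 0
  above a b p :=
    if toLex a < toLex p ∧ toLex p < toLex b ∧ 0 < orient a b p ∨
      toLex b < toLex p ∧ toLex p < toLex a ∧ 0 < orient b a p then 1 else 0
  left_add_left {a b} hab := by
    rcases lt_or_gt_of_ne (toLex.injective.ne hab) with h | h <;> simp [h, h.not_gt]

theorem planeDrawing_above_swap (a b p : Plane) :
    planeDrawing.above b a p = planeDrawing.above a b p := by
  simp only [planeDrawing, or_comm]

theorem planeDrawing_crossing_swap_left (a b c d : Plane) :
    planeDrawing.crossing b a c d = planeDrawing.crossing a b c d := by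
  simp only [ParityDrawing.crossing, planeDrawing_above_swap b a]
  ring

theorem planeDrawing_crossing_swap_right (a b c d : Plane) :
    planeDrawing.crossing a b d c = planeDrawing.crossing a b c d := by
  simp only [ParityDrawing.crossing, planeDrawing_above_swap d c]
  ring

theorem planeDrawing_crossing_eq_zero_of_lt (hcd : toLex c ≤ toLex d)
    (hac : toLex a < toLex c) (h : Disjoint (segment ℝ a b) (segment ℝ c d)) :
    planeDrawing.crossing a b c d = 0 := by
  have hbc : b ≠ c := h.ne_of_mem (right_mem_segment ℝ a b) (left_mem_segment ℝ c d)
  have hbd : b ≠ d := h.ne_of_mem (right_mem_segment ℝ a b) (right_mem_segment ℝ c d)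
  have had := hac.trans_le hcd
  simp only [ParityDrawing.crossing, planeDrawing, hac.not_gt, had.not_gt, hac, had]
  rcases lt_or_gt_of_ne (toLex.injective.ne hbc) with hbc | hcb
  · have hbd := hbc.trans_le hcd
    simp only [hbc, hbd, hbc.not_gt, hbd.not_gt, true_and, false_and,
      and_false, or_false, if_true, if_false]
    rfl
  rcases lt_or_gt_of_ne (toLex.injective.ne hbd) with hbd | hdb
  · have := orient_pos_iff_of_interlaced hac hcb hbd h
    simp only [hcb, hbd, hcb.not_gt, hbd.not_gt, this, true_and, false_and,
      and_false, or_false, if_true, if_false]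
    split_ifs <;> rfl
  · have := orient_pos_iff_of_nested hac hcd hdb h
    simp only [hcb, hdb, hcb.not_gt, hdb.not_gt, this, true_and, false_and,
      and_false, or_false, if_true, if_false]
    split_ifs <;> rfl

theorem planeDrawing_crossing_eq_zero (h : Disjoint (segment ℝ a b) (segment ℝ c d)) :
    planeDrawing.crossing a b c d = 0 := by
  wlog hab : toLex a ≤ toLex b generalizing a b
  · rw [← planeDrawing_crossing_swap_left]
    exact this (segment_symm ℝ a b ▸ h) (le_of_not_ge hab)
  wlog hcd : toLex c ≤ toLex d generalizing c d
  · rw [← planeDrawing_crossing_swap_right]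
    exact this (segment_symm ℝ c d ▸ h) (le_of_not_ge hcd)
  have hac : a ≠ c := h.ne_of_mem (left_mem_segment ℝ a b) (left_mem_segment ℝ c d)
  have had : a ≠ d := h.ne_of_mem (left_mem_segment ℝ a b) (right_mem_segment ℝ c d)
  have hbc : b ≠ c := h.ne_of_mem (right_mem_segment ℝ a b) (left_mem_segment ℝ c d)
  have hbd : b ≠ d := h.ne_of_mem (right_mem_segment ℝ a b) (right_mem_segment ℝ c d)
  rcases lt_or_gt_of_ne (toLex.injective.ne hac) with hac_lt | hca_lt
  · exact planeDrawing_crossing_eq_zero_of_lt hcd hac_lt h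
  · rw [← planeDrawing.crossing_comm hac had hbc hbd]
    exact planeDrawing_crossing_eq_zero_of_lt hab hca_lt h.symm

theorem PlaneEmbedding.disjoint_arc {V : Type} {G : SimpleGraph V} (E : PlaneEmbedding G)
    {a b c d : V} (hab : G.Adj a b) (hcd : G.Adj c d) (hac : a ≠ c) (had : a ≠ d) (hbc : b ≠ c)
    (hbd : b ≠ d) : Disjoint (E.arc s(a, b)) (E.arc s(c, d)) := by
  refine Set.disjoint_left.2 fun z hz_ab hz_cd => ?_
  by_cases hz : z ∈ E.point '' {w | w ∈ s(a, b)}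
  · obtain ⟨w, hw, rfl⟩ := hz
    refine Set.disjoint_left.1 (E.interior_disjoint_vertices _ hcd) ⟨hz_cd, ?_⟩ ⟨w, rfl⟩
    rw [E.point_injective.mem_set_image]
    simp only [Set.mem_ofPred_eq, Sym2.mem_iff] at hw ⊢
    grind
  · exact Set.disjoint_left.1 (E.interior_disjoint_edges _ hab _ hcd (by grind)) ⟨hz_ab, hz⟩ hz_cd

theorem IsPlanar.independentlyEven {V : Type} {G : SimpleGraph V} (hG : IsPlanar G) :
    IndependentlyEven G := by
  obtain ⟨E⟩ := hG
  have exists_path (a b : V) : ∃ (q : ℕ → Plane) (n : ℕ), G.Adj a b →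
      q 0 = E.point a ∧ q n = E.point b ∧
        ∀ k < n, segment ℝ (q k) (q (k + 1)) ⊆ E.arc s(a, b) := by
    by_cases hab : G.Adj a b
    · obtain ⟨n, q, q_zero, q_succ, arc_eq, -⟩ := E.isPolygonalArc a b hab
      refine ⟨q, n + 1, fun _ => ⟨q_zero, q_succ, fun k hk => arc_eq ▸ ?_⟩⟩
      exact Set.subset_biUnion_of_mem (u := fun i => segment ℝ (q i) (q (i + 1)))
        (Set.mem_Iic.2 (Nat.le_of_lt_succ hk))
    · exact ⟨0, 0, fun h => absurd h hab⟩
  choose q n hq using exists_path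
  refine independentlyEven_of_paths planeDrawing E.point_injective q n
    (fun a b hab => (hq a b hab).1) (fun a b hab => (hq a b hab).2.1) ?_
  intro a b c d hab hcd hac had hbc hbd k hk l hl
  exact planeDrawing_crossing_eq_zero <| (E.disjoint_arc hab hcd hac had hbc hbd).mono
    ((hq a b hab).2.2 k hk) ((hq c d hcd).2.2 l hl)

end PlaneDrawing

/-! ### Density of independently even graphs -/

section Density

open Finset

variable {V : Type*} {K : SimpleGraph V} {x y : V}

/-- The graph obtained from `K` by contracting the edge `xy` into `x`. The set of vertices is
kept, and `y` becomes isolated. -/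
def contract (K : SimpleGraph V) (x y : V) : SimpleGraph V :=
  SimpleGraph.fromRel fun a b => a ≠ y ∧ b ≠ y ∧ (K.Adj a b ∨ a = x ∧ K.Adj y b)

theorem contract_adj {a b : V} : (contract K x y).Adj a b ↔
    a ≠ b ∧ a ≠ y ∧ b ≠ y ∧ (K.Adj a b ∨ a = x ∧ K.Adj y b ∨ b = x ∧ K.Adj a y) := by
  simp only [contract, SimpleGraph.fromRel_adj, K.adj_comm b a, K.adj_comm a y]
  tauto

theorem IndependentlyEven.contract (hK : IndependentlyEven K) (hxy : K.Adj x y) :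
    IndependentlyEven (contract K x y) := by
  refine hK.of_walks Function.injective_id
    (fun a b => {v | v = a ∨ v = b ∨ v = y ∧ (a = x ∨ b = x)}) (fun a b hab => ?_)
    fun a b c d hab hcd hac had hbc hbd => Set.disjoint_left.2 fun v hv hv' => ?_
  · obtain ⟨-, -, -, h | ⟨rfl, h⟩ | ⟨rfl, h⟩⟩ := contract_adj.1 hab
    · exact ⟨h.toWalk, by simp⟩
    · exact ⟨.cons hxy h.toWalk, by simp⟩
    · exact ⟨.cons h hxy.symm.toWalk, by simp⟩
  · obtain ⟨-, hay, hby, -⟩ := contract_adj.1 hab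
    obtain ⟨-, hcy, hdy, -⟩ := contract_adj.1 hcd
    simp only [Set.mem_ofPred_eq] at hv hv'
    clear hab hcd
    grind only

theorem IndependentlyEven.cliqueFree_five (hK : IndependentlyEven K) : K.CliqueFree 5 := by
  by_contra h
  have φ := SimpleGraph.topEmbeddingOfNotCliqueFree h
  refine not_independentlyEven_top_five <| hK.of_walks φ.injective (fun a b => {φ a, φ b})
    (fun a b hab => ⟨(φ.map_adj_iff.2 hab).toWalk, by simp⟩)
    fun a b c d _ _ hac had hbc hbd => ?_
  simp [φ.injective.eq_iff, hac.symm, had.symm, hbc.symm, hbd.symm]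

section Contraction

variable [DecidableEq V]

/-- `Q` is a clique of `K` with `q` vertices, all of them adjacent to every vertex of `U`. -/
structure IsApexClique (K : SimpleGraph V) (q : ℕ) (Q U : Finset V) : Prop where
  isNClique : K.IsNClique q Q
  adj : ∀ a ∈ Q, ∀ u ∈ U, K.Adj a u

theorem IsApexClique.contract {q : ℕ} {Q U : Finset V} (hQ : IsApexClique K q Q U) (hy : y ∈ U) :
    IsApexClique (contract K x y) q Q (U.erase y) where
  isNClique := ⟨fun a ha b hb hab => contract_adj.2 ⟨hab, (hQ.adj a ha y hy).ne,
    (hQ.adj b hb y hy).ne, .inl (hQ.isNClique.isClique ha hb hab)⟩, hQ.isNClique.card_eq⟩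
  adj a ha u hu := contract_adj.2 ⟨(hQ.adj a ha u (mem_of_mem_erase hu)).ne,
    (hQ.adj a ha y hy).ne, ne_of_mem_erase hu, .inl (hQ.adj a ha u (mem_of_mem_erase hu))⟩

variable [DecidableRel K.Adj]

theorem card_interedges_le_erase (K : SimpleGraph V) [DecidableRel K.Adj] (U : Finset V) (y : V) :
    #(K.interedges U U) ≤
      #(K.interedges (U.erase y) (U.erase y)) + 2 * #{z ∈ U | K.Adj y z} := by
  set N : Finset V := {z ∈ U | K.Adj y z}
  have cover : K.interedges U U ⊆
      K.interedges (U.erase y) (U.erase y) ∪ ({y} ×ˢ N ∪ N ×ˢ {y}) := by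
    rintro ⟨a, b⟩ h
    obtain ⟨ha, hb, hab⟩ := K.mk_mem_interedges_iff.1 h
    have := hab.symm
    simp only [N, mem_union, SimpleGraph.mk_mem_interedges_iff, mem_product, mem_filter,
      mem_erase, mem_singleton]
    grind
  calc #(K.interedges U U) ≤ _ := card_le_card cover
    _ ≤ _ + _ := card_union_le _ _
    _ ≤ _ + (#({y} ×ˢ N) + #(N ×ˢ {y})) := by gcongr; exact card_union_le _ _
    _ = #(K.interedges (U.erase y) (U.erase y)) + 2 * #N := by
      simp only [card_product, card_singleton]; ring

theorem card_interedges_add_le_contract [DecidableRel (contract K x y).Adj] {U : Finset V}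
    (hx : x ∈ U) (hxy : x ≠ y) :
    #(K.interedges (U.erase y) (U.erase y)) +
        2 * #{z ∈ U.erase y | K.Adj y z ∧ z ≠ x ∧ ¬ K.Adj x z} ≤
      #((contract K x y).interedges (U.erase y) (U.erase y)) := by
  set N : Finset V := {z ∈ U.erase y | K.Adj y z ∧ z ≠ x ∧ ¬ K.Adj x z}
  have mem_N {z : V} (hz : z ∈ N) : (z ≠ y ∧ z ∈ U) ∧ K.Adj y z ∧ z ≠ x ∧ ¬ K.Adj x z := by
    simpa only [N, mem_filter, mem_erase] using hz
  have disjoint_new : Disjoint ({x} ×ˢ N) (N ×ˢ {x}) := by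
    refine Finset.disjoint_left.2 fun ⟨a, b⟩ h h' => ?_
    exact (mem_N (mem_product.1 h').1).2.2.1 (mem_singleton.1 (mem_product.1 h).1)
  have disjoint_old : Disjoint (K.interedges (U.erase y) (U.erase y))
      ({x} ×ˢ N ∪ N ×ˢ {x}) := by
    refine Finset.disjoint_left.2 fun ⟨a, b⟩ h h' => ?_
    have hab := (K.mk_mem_interedges_iff.1 h).2.2
    simp only [mem_union, mem_product, mem_singleton] at h'
    obtain ⟨rfl, hb⟩ | ⟨ha, rfl⟩ := h'
    · exact (mem_N hb).2.2.2 hab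
    · exact (mem_N ha).2.2.2 hab.symm
  have cover : K.interedges (U.erase y) (U.erase y) ∪ ({x} ×ˢ N ∪ N ×ˢ {x}) ⊆
      (contract K x y).interedges (U.erase y) (U.erase y) := by
    rintro ⟨a, b⟩ h
    simp only [mem_union, mem_product, mem_singleton, SimpleGraph.mk_mem_interedges_iff,
      mem_erase, contract_adj, K.adj_comm a y] at h ⊢
    have := K.ne_of_adj (a := a) (b := b)
    grind
  calc _ = #(K.interedges (U.erase y) (U.erase y) ∪ ({x} ×ˢ N ∪ N ×ˢ {x})) := by
        rw [card_union_of_disjoint disjoint_old, card_union_of_disjoint disjoint_new,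
          card_product, card_product, card_singleton]
        ring
    _ ≤ _ := card_le_card cover

theorem card_interedges_le_contract [DecidableRel (contract K x y).Adj] {U : Finset V}
    (hx : x ∈ U) (hxy : K.Adj x y) :
    #(K.interedges U U) ≤ #((contract K x y).interedges (U.erase y) (U.erase y)) +
      2 * (#{z ∈ U | K.Adj x z ∧ K.Adj y z} + 1) := by
  have neighbors_le : #{z ∈ U | K.Adj y z} ≤
      #{z ∈ U.erase y | K.Adj y z ∧ z ≠ x ∧ ¬ K.Adj x z} +
        (#{z ∈ U | K.Adj x z ∧ K.Adj y z} + 1) := by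
    calc _ ≤ #({z ∈ U.erase y | K.Adj y z ∧ z ≠ x ∧ ¬ K.Adj x z} ∪
          insert x {z ∈ U | K.Adj x z ∧ K.Adj y z}) := card_le_card fun z hz => by
            have := hxy.ne
            have := K.ne_of_adj (a := y) (b := z)
            grind
      _ ≤ _ := (card_union_le _ _).trans (by gcongr; exact card_insert_le _ _)
  have upper := card_interedges_le_erase K U y
  have lower := card_interedges_add_le_contract (K := K) hx hxy.ne
  omega

theorem IsApexClique.link {q : ℕ} {Q U : Finset V} (hQ : IsApexClique K q Q U) (hx : x ∈ U) :
    IsApexClique K (q + 1) (insert x Q) {z ∈ U | K.Adj x z} where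
  isNClique := hQ.isNClique.insert fun a ha => (hQ.adj a ha x hx).symm
  adj a ha u hu := by
    obtain ⟨huU, hxu⟩ := mem_filter.1 hu
    obtain rfl | ha := mem_insert.1 ha
    · exact hxu
    · exact hQ.adj a ha u huU

end Contraction

theorem mul_card_le_card_interedges [DecidableRel K.Adj] {S U : Finset V} {d : ℕ}
    (h : ∀ x ∈ S, d ≤ #{z ∈ U | K.Adj x z}) : d * #S ≤ #(K.interedges S U) := by
  classical
  rw [card_eq_sum_card_fiberwise (f := Prod.fst) (t := S)
    fun e he => (K.mem_interedges_iff.1 he).1, mul_comm, ← smul_eq_mul]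
  refine card_nsmul_le_sum _ _ _ fun x hx => (h x hx).trans ?_
  refine card_le_card_of_injOn (fun z => (x, z)) (fun z hz => ?_) (by simp)
  obtain ⟨hz, hxz⟩ := mem_filter.1 hz
  simp [SimpleGraph.mk_mem_interedges_iff, hx, hz, hxz]

/-- The average degree inside a nonempty set of vertices that are joined to a common `q`-clique is
less than `d`, in every independently even graph on `V`. -/
def IsAverageDegreeBound (V : Type*) (q d : ℕ) : Prop :=
  ∀ (K : SimpleGraph V) [DecidableRel K.Adj] (Q U : Finset V), IndependentlyEven K →
    IsApexClique K q Q U → U.Nonempty → #(K.interedges U U) < d * #U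

theorem isAverageDegreeBound_three : IsAverageDegreeBound V 3 1 := by
  classical
  intro K _ Q U hK hQ hU
  suffices h : K.interedges U U = ∅ by simpa [h] using hU
  refine eq_empty_of_forall_notMem fun ⟨x, y⟩ h => ?_
  obtain ⟨hx, hy, hxy⟩ := K.mk_mem_interedges_iff.1 h
  exact hK.cliqueFree_five _ ((hQ.link hx).link (mem_filter.2 ⟨hy, hxy⟩)).isNClique

theorem IsAverageDegreeBound.two_mul {q d : ℕ} (hd : 0 < d) (h : IsAverageDegreeBound V (q + 1) d) :
    IsAverageDegreeBound V q (2 * d) := by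
  classical
  intro K _ Q U hK hQ hU
  induction hn : #U using Nat.strong_induction_on generalizing K U with | _ n ih
  subst hn
  by_contra! dense
  have common_ge : ∀ x ∈ U, ∀ y ∈ U, K.Adj x y → d ≤ #{z ∈ U | K.Adj x z ∧ K.Adj y z} := by
    intro x hx y hy hxy
    by_contra! few_common
    have card_U := card_erase_add_one hy
    have smaller := ih _ (by omega) _ (U.erase y) (hK.contract hxy) (hQ.contract hy)
      ⟨x, mem_erase.2 ⟨hxy.ne, hx⟩⟩ rfl
    have := card_interedges_le_contract hx hxy
    rw [← card_U, mul_add] at dense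
    omega
  have nonempty : (K.interedges U U).Nonempty := card_pos.1 <|
    (Nat.mul_pos (by omega) hU.card_pos).trans_le dense
  obtain ⟨⟨x, y⟩, hxy⟩ := nonempty
  obtain ⟨hx, hy, hxy⟩ := K.mk_mem_interedges_iff.1 hxy
  refine (h K _ _ hK (hQ.link hx) ⟨y, mem_filter.2 ⟨hy, hxy⟩⟩).not_ge
    (mul_card_le_card_interedges fun z hz => ?_)
  obtain ⟨hzU, hxz⟩ := mem_filter.1 hz
  simpa only [filter_filter] using common_ge x hx z hzU hxz

theorem IndependentlyEven.card_interedges_lt [DecidableRel K.Adj] (hK : IndependentlyEven K)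
    {U : Finset V} (hU : U.Nonempty) : #(K.interedges U U) < 8 * #U := by
  have bound : IsAverageDegreeBound V 0 8 :=
    ((isAverageDegreeBound_three.two_mul one_pos).two_mul two_pos).two_mul four_pos
  exact bound K ∅ U hK ⟨SimpleGraph.isNClique_empty.2 rfl, by simp⟩ hU

end Density

/-! ### Defective colorings -/

section HasDefect

variable {V α : Type*} {G : SimpleGraph V} {c : V → α} {D : ℕ} {x y : V}

/-- Every vertex has at most `D` neighbors of its own color. This is the condition of
`IsDefectiveColorable` for a constant tuple, without the induced subgraphs. -/
def HasDefect (G : SimpleGraph V) (c : V → α) (D : ℕ) : Prop :=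
  ∀ v, {w | G.Adj v w ∧ c w = c v}.ncard ≤ D

theorem isDefectiveColorable_iff {V : Type} [Finite V] {G : SimpleGraph V} {k D : ℕ} :
    IsDefectiveColorable G (fun _ : Fin k => D) ↔ ∃ c : V → Fin k, HasDefect G c D := by
  have ncard_eq (c : V → Fin k) (v : V) :
      ((G.induce {w | c w = c v}).neighborSet ⟨v, rfl⟩).ncard =
        {w | G.Adj v w ∧ c w = c v}.ncard := by
    rw [← Set.ncard_image_of_injective _ Subtype.val_injective]
    congr 1
    ext w
    simp [and_comm]
  refine exists_congr fun c => ⟨fun h v => ncard_eq c v ▸ h (c v) ⟨v, rfl⟩, ?_⟩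
  rintro h i ⟨v, rfl⟩
  exact (ncard_eq c v).trans_le (h v)

theorem hasDefect_zero (C : G.Coloring α) : HasDefect G C 0 := by
  intro v
  have : {w | G.Adj v w ∧ C w = C v} = ∅ :=
    Set.eq_empty_of_forall_notMem fun w hw => C.valid hw.1 hw.2.symm
  rw [this, Set.ncard_empty]

variable [Finite V]

theorem HasDefect.of_deleteEdges (hc : HasDefect (G.deleteEdges {s(x, y)}) c D)
    (hx : (G.neighborSet x).ncard ≤ D) (hy : (G.neighborSet y).ncard ≤ D) : HasDefect G c D := by
  intro v
  by_cases hv : v = x ∨ v = y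
  · calc _ ≤ (G.neighborSet v).ncard := Set.ncard_le_ncard fun w hw => hw.1
      _ ≤ D := by obtain rfl | rfl := hv <;> assumption
  · refine (Set.ncard_le_ncard ?_).trans (hc v)
    rintro w ⟨hvw, hcw⟩
    rw [not_or] at hv
    exact ⟨by simp [hvw, hv], hcw⟩

theorem HasDefect.update_leaf [DecidableEq V] (hc : HasDefect (G.deleteEdges {s(x, y)}) c D)
    (hx : G.neighborSet x = {y}) {i : α} (hi : i ≠ c y) :
    HasDefect G (Function.update c x i) D := by
  have adj_iff (w : V) : G.Adj x w ↔ w = y := Set.ext_iff.1 hx w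
  have hyx : y ≠ x := ((adj_iff y).2 rfl).ne'
  intro v
  obtain rfl | hv := eq_or_ne v x
  · suffices h : {w | G.Adj v w ∧ Function.update c v i w = Function.update c v i v} = ∅ by
      rw [h, Set.ncard_empty]
      exact D.zero_le
    refine Set.eq_empty_of_forall_notMem fun w ⟨hw, hcw⟩ => hi ?_
    rw [(adj_iff w).1 hw, Function.update_self, Function.update_of_ne hyx] at hcw
    exact hcw.symm
  · refine (Set.ncard_le_ncard ?_).trans (hc v)
    rintro w ⟨hvw, hcw⟩
    obtain rfl | hw := eq_or_ne w x
    · obtain rfl := (adj_iff v).1 hvw.symm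
      rw [Function.update_self, Function.update_of_ne hv] at hcw
      exact absurd hcw hi
    · rw [Function.update_of_ne hv, Function.update_of_ne hw] at hcw
      exact ⟨by simp [hvw, hv, hw], hcw⟩

theorem exists_hasDefect_of_leaf_or_light_edge [Nontrivial α]
    (h : ∀ H ≤ G, H ≠ ⊥ → (∃ x, (H.neighborSet x).ncard = 1) ∨
      ∃ x y, H.Adj x y ∧ (H.neighborSet x).ncard ≤ D ∧ (H.neighborSet y).ncard ≤ D) :
    ∃ c : V → α, HasDefect G c D := by
  classical
  induction G using WellFoundedLT.induction with | _ G ih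
  have exists_deleteEdges {x y : V} (hxy : G.Adj x y) :
      ∃ c : V → α, HasDefect (G.deleteEdges {s(x, y)}) c D := by
    have hlt : G.deleteEdges {s(x, y)} < G :=
      (G.deleteEdges_le _).lt_of_not_ge fun hle => by simpa using hle hxy
    exact ih _ hlt fun H hH => h H (hH.trans hlt.le)
  obtain rfl | hG := eq_or_ne G ⊥
  · exact ⟨fun _ => Classical.arbitrary α, fun v => by simp⟩
  obtain ⟨x, hx⟩ | ⟨x, y, hxy, hx, hy⟩ := h G le_rfl hG
  · obtain ⟨y, hy⟩ := Set.ncard_eq_one.1 hx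
    obtain ⟨c, hc⟩ := exists_deleteEdges (x := x) (y := y) (Set.ext_iff.1 hy y |>.2 rfl)
    obtain ⟨i, hi⟩ := exists_ne (c y)
    exact ⟨_, hc.update_leaf hy hi⟩
  · obtain ⟨c, hc⟩ := exists_deleteEdges hxy
    exact ⟨c, hc.of_deleteEdges hx hy⟩

end HasDefect

/-! ### Planar graphs without four-cycles -/

section FourCycleFree

open Finset

variable {V : Type*} {G : SimpleGraph V}

theorem cycleGraph_four_isContained {a b a' b' : V} (ha : a ≠ a') (hb : b ≠ b')
    (hab : G.Adj a b) (hab' : G.Adj a b') (ha'b : G.Adj a' b) (ha'b' : G.Adj a' b') :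
    (SimpleGraph.cycleGraph 4).IsContained G := by
  rw [SimpleGraph.cycleGraph_isContained_iff (by norm_num)]
  refine ⟨a, .cons hab (.cons ha'b.symm (.cons ha'b' (.cons hab'.symm .nil))), ?_, rfl⟩
  rw [SimpleGraph.Walk.isCycle_iff_isPath_tail_and_le_length]
  simp [SimpleGraph.Walk.isPath_def, ha'b.ne', hb, hab.ne', ha'b'.ne, ha.symm, hab'.ne']

/-- The graph in which every vertex `a` of `A` is replaced by an edge joining its neighbors `f a`
and `g a`. -/
def suppress (A : Set V) (f g : V → V) : SimpleGraph V :=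
  SimpleGraph.fromRel fun x y => ∃ a ∈ A, x = f a ∧ y = g a

theorem IndependentlyEven.suppress (hG : IndependentlyEven G) {A : Set V} {f g : V → V}
    (hf : ∀ a ∈ A, G.Adj a (f a) ∧ f a ∉ A) (hg : ∀ a ∈ A, G.Adj a (g a) ∧ g a ∉ A) :
    IndependentlyEven (suppress A f g) := by
  have exists_middle {x y : V} (h : (ImproperColoring.suppress A f g).Adj x y) :
      x ∉ A ∧ y ∉ A ∧ ∃ a ∈ A, G.Adj x a ∧ G.Adj a y ∧ s(x, y) = s(f a, g a) := by
    obtain ⟨-, ⟨a, ha, rfl, rfl⟩ | ⟨a, ha, rfl, rfl⟩⟩ := h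
    · exact ⟨(hf a ha).2, (hg a ha).2, a, ha, (hf a ha).1.symm, (hg a ha).1, rfl⟩
    · exact ⟨(hg a ha).2, (hf a ha).2, a, ha, (hg a ha).1.symm, (hf a ha).1, Sym2.eq_swap⟩
  refine hG.of_walks Function.injective_id
    (fun x y => {v | v = x ∨ v = y ∨ v ∈ A ∧ s(x, y) = s(f v, g v)}) (fun x y h => ?_)
    fun x y z w hxy hzw hxz hxw hyz hyw => Set.disjoint_left.2 fun v hv hv' => ?_
  · obtain ⟨-, -, a, ha, hxa, hay, hs⟩ := exists_middle h
    exact ⟨.cons hxa hay.toWalk, by simp [ha, hs]⟩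
  · obtain ⟨hx, hy, -⟩ := exists_middle hxy
    obtain ⟨hz, hw, -⟩ := exists_middle hzw
    have hne : s(x, y) ≠ s(z, w) := by simp [hxz, hxw]
    simp only [Set.mem_ofPred_eq] at hv hv'
    clear hxy hzw exists_middle hf hg hG
    grind only

theorem IndependentlyEven.card_lt_of_two_neighbors (hG : IndependentlyEven G)
    (h4 : ¬ (SimpleGraph.cycleGraph 4).IsContained G) {A B : Finset V} (hAB : Disjoint A B)
    (hB : B.Nonempty)
    (h : ∀ a ∈ A, ∃ b ∈ B, ∃ b' ∈ B, b ≠ b' ∧ G.Adj a b ∧ G.Adj a b') : #A < 8 * #B := by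
  classical
  choose! f hfB g hgB hfg hf hg using h
  have notMem {b : V} (hb : b ∈ B) : b ∉ (A : Set V) := Finset.disjoint_right.1 hAB hb
  have even := hG.suppress (fun a ha => ⟨hf a ha, notMem (hfB a ha)⟩)
    (fun a ha => ⟨hg a ha, notMem (hgB a ha)⟩)
  refine lt_of_le_of_lt ?_ (even.card_interedges_lt hB)
  refine card_le_card_of_injOn (fun a => (f a, g a)) (fun a ha => ?_) fun a ha a' ha' h => ?_
  · exact (SimpleGraph.mk_mem_interedges_iff _).2
      ⟨hfB a ha, hgB a ha, hfg a ha, .inl ⟨a, ha, rfl, rfl⟩⟩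
  · obtain ⟨hf', hg'⟩ := Prod.mk.inj h
    by_contra hne
    exact h4 (cycleGraph_four_isContained hne (hfg a ha) (hf a ha) (hg a ha)
      (hf' ▸ hf a' ha') (hg' ▸ hg a' ha'))

theorem IndependentlyEven.exists_leaf_or_light_edge [Finite V] (hG : IndependentlyEven G)
    (h4 : ¬ (SimpleGraph.cycleGraph 4).IsContained G) (hne : G ≠ ⊥) :
    (∃ x, (G.neighborSet x).ncard = 1) ∨
      ∃ x y, G.Adj x y ∧ (G.neighborSet x).ncard ≤ 72 ∧ (G.neighborSet y).ncard ≤ 72 := by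
  classical
  have := Fintype.ofFinite V
  by_contra! ⟨no_leaf, heavy_of_light⟩
  let A : Finset V := {v | 2 ≤ (G.neighborSet v).ncard ∧ (G.neighborSet v).ncard ≤ 72}
  let B : Finset V := {v | 72 < (G.neighborSet v).ncard}
  have mem_A {v : V} : v ∈ A ↔ 2 ≤ (G.neighborSet v).ncard ∧ (G.neighborSet v).ncard ≤ 72 := by
    simp [A]
  have mem_B {v : V} : v ∈ B ↔ 72 < (G.neighborSet v).ncard := by simp [B]
  have mem_union_of_adj {x y : V} (h : G.Adj x y) : x ∈ A ∪ B := by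
    have : 0 < (G.neighborSet x).ncard := (Set.ncard_pos (Set.toFinite _)).2 ⟨y, h⟩
    have := no_leaf x
    rw [mem_union, mem_A, mem_B]
    omega
  have mem_B_of_adj {a b : V} (ha : a ∈ A) (h : G.Adj a b) : b ∈ B :=
    mem_B.2 (heavy_of_light a b h (mem_A.1 ha).2)
  have nonempty_B : B.Nonempty := by
    obtain ⟨x, y, hxy⟩ := SimpleGraph.ne_bot_iff_exists_adj.1 hne
    exact (mem_union.1 (mem_union_of_adj hxy)).elim (fun h => ⟨y, mem_B_of_adj h hxy⟩)
      fun h => ⟨x, h⟩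
  have card_A : #A < 8 * #B := by
    refine hG.card_lt_of_two_neighbors h4 (Finset.disjoint_left.2 fun v hA hB => ?_) nonempty_B
      fun a ha => ?_
    · exact (mem_A.1 hA).2.not_gt (mem_B.1 hB)
    · obtain ⟨b, b', hb, hb', hne⟩ := (Set.one_lt_ncard_iff (Set.toFinite _)).1 (mem_A.1 ha).1
      exact ⟨b, mem_B_of_adj ha hb, b', mem_B_of_adj ha hb', hne, hb, hb'⟩
  have lower : 72 * #B ≤ #(G.interedges (A ∪ B) (A ∪ B)) := by
    refine (mul_card_le_card_interedges fun b hb => (mem_B.1 hb).le.trans ?_).trans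
      (card_le_card (G.interedges_mono subset_union_right subset_rfl))
    rw [← Set.ncard_coe_finset]
    exact Set.ncard_le_ncard fun w hw => mem_filter.2 ⟨mem_union_of_adj hw.symm, hw⟩
  have upper := hG.card_interedges_lt (U := A ∪ B) (nonempty_B.mono subset_union_right)
  have := card_union_le A B
  omega

theorem IndependentlyEven.exists_hasDefect [Finite V] {α : Type*} [Nontrivial α]
    (hG : IndependentlyEven G) (h4 : ¬ (SimpleGraph.cycleGraph 4).IsContained G) :
    ∃ c : V → α, HasDefect G c 72 :=
  exists_hasDefect_of_leaf_or_light_edge fun _ hle =>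
    (hG.mono hle).exists_leaf_or_light_edge fun h => h4 (h.mono_right hle)

theorem isBalancedObstructionSet_of_fourCycle_mem {k : ℕ} {S : Set CycleLength}
    (hS : fourCycle ∈ S) : IsBalancedObstructionSet (k + 2) S :=
  ⟨72, fun _ _ _ hG => isDefectiveColorable_iff.2 <|
    hG.1.independentlyEven.exists_hasDefect (hG.2 _ hS)⟩

end FourCycleFree

/-! ### Graphs without odd cycles -/

section OddCycles

variable {V : Type*} {G : SimpleGraph V}

theorem even_length_add_length_bypass [DecidableEq V]
    (hG : ∀ (v : V) (c : G.Walk v v), c.IsCycle → Even c.length) {u v : V} (p : G.Walk u v) :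
    Even (p.length + p.bypass.length) := by
  induction p with
  | nil => exact Even.zero
  | @cons u v w h p ih =>
    rw [SimpleGraph.Walk.bypass]
    split_ifs with hu
    · set back := p.bypass.takeUntil u hu
      have back_pos : back.length ≠ 0 := fun h0 => h.ne (back.eq_of_length_eq_zero h0).symm
      have split := congrArg SimpleGraph.Walk.length (p.bypass.take_spec hu)
      rw [SimpleGraph.Walk.length_append] at split
      have odd_back : Odd back.length := by
        by_contra! even_back
        have isCycle : (SimpleGraph.Walk.cons h back).IsCycle := by
          rw [SimpleGraph.Walk.isCycle_iff_isPath_tail_and_le_length]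
          refine ⟨by simpa using p.bypass_isPath.takeUntil hu, ?_⟩
          rw [SimpleGraph.Walk.length_cons]
          grind
        have := hG u _ isCycle
        rw [SimpleGraph.Walk.length_cons] at this
        grind
      rw [SimpleGraph.Walk.length_cons]
      grind
    · rw [SimpleGraph.Walk.length_cons, SimpleGraph.Walk.length_cons]
      grind

theorem colorable_two_of_forall_isCycle_even
    (hG : ∀ (v : V) (c : G.Walk v v), c.IsCycle → Even c.length) : G.Colorable 2 := by
  classical
  refine SimpleGraph.two_colorable_iff_forall_loop_even.2 fun u w => ?_
  have bypass_nil := SimpleGraph.Walk.isPath_iff_nil.1 w.bypass_isPath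
  simpa [SimpleGraph.Walk.length_eq_zero_iff.2 bypass_nil] using
    even_length_add_length_bypass hG w

theorem isBalancedObstructionSet_of_oddCycles_subset {k : ℕ} {S : Set CycleLength}
    (hS : oddCycles ⊆ S) : IsBalancedObstructionSet (k + 2) S := by
  refine ⟨0, fun V _ G hG => isDefectiveColorable_iff.2 ?_⟩
  have even_cycles (v : V) (c : G.Walk v v) (hc : c.IsCycle) : Even c.length := by
    by_contra! hodd
    exact hG.2 ⟨c.length, hc.three_le_length⟩ (hS (Nat.not_even_iff_odd.1 hodd))
      ((SimpleGraph.cycleGraph_isContained_iff hc.three_le_length).2 ⟨v, c, hc, rfl⟩)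
  obtain ⟨C⟩ := (colorable_two_of_forall_isCycle_even even_cycles).mono (Nat.le_add_left 2 k)
  exact ⟨C, hasDefect_zero C⟩

end OddCycles

/-! ### The necklace graph -/

section Necklace

open Finset

/-- The vertices of the necklace graph, arranged in columns `0, …, 2 * r`. Column `0` consists of
the root. The other even columns contain one bead for each of the `D + 1` strands, and the odd
columns contain `2 * D + 1` links for each strand, which are told apart by their index. The fields
that are not needed to name a vertex are set to `0`. -/
@[ext]
structure NecklaceVertex (r D : ℕ) where
  column : ℕ
  strand : ℕ
  index : ℕ
  column_le : column ≤ 2 * r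
  strand_le : strand ≤ D
  index_le : index ≤ 2 * D
  index_eq_zero : Even column → index = 0
  strand_eq_zero : column = 0 → strand = 0

variable {r D : ℕ}

namespace NecklaceVertex

instance : Finite (NecklaceVertex r D) :=
  .of_injective (β := Fin (2 * r + 1) × Fin (D + 1) × Fin (2 * D + 1))
    (fun v => (⟨v.column, Nat.lt_succ_of_le v.column_le⟩, ⟨v.strand, Nat.lt_succ_of_le v.strand_le⟩,
      ⟨v.index, Nat.lt_succ_of_le v.index_le⟩))
    fun u v h => by simpa [NecklaceVertex.ext_iff] using h

/-- The common vertex of all strands, in column `0`. -/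
def root : NecklaceVertex r D :=
  ⟨0, 0, 0, Nat.zero_le _, Nat.zero_le _, Nat.zero_le _, fun _ => rfl, fun _ => rfl⟩

theorem eq_root {v : NecklaceVertex r D} (h : v.column = 0) : v = root :=
  NecklaceVertex.ext h (v.strand_eq_zero h) (v.index_eq_zero (h ▸ Even.zero))

/-- The edges between consecutive columns: `v` is in the column after `u`, on the same strand. -/
def StepUp (u v : NecklaceVertex r D) : Prop :=
  v.column = u.column + 1 ∧ (u.column = 0 ∨ u.strand = v.strand)

/-- The closing edges: `u` is the root and `v` is the last bead of a strand. -/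
def ClosesUp (u v : NecklaceVertex r D) : Prop :=
  u.column = 0 ∧ v.column = 2 * r

/-- Two links that join the same beads. -/
def Twins (u w : NecklaceVertex r D) : Prop :=
  Odd u.column ∧ u.column = w.column ∧ u.strand = w.strand

end NecklaceVertex

open NecklaceVertex

/-- The necklace graph: on every strand consecutive beads are joined through `2 * D + 1` links, all
strands start at the root, and the last bead of every strand is joined to the root. -/
def necklace (r D : ℕ) : SimpleGraph (NecklaceVertex r D) :=
  SimpleGraph.fromRel fun u v => StepUp u v ∨ ClosesUp u v

theorem necklace_adj {u v : NecklaceVertex r D} : (necklace r D).Adj u v ↔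
    u ≠ v ∧ ((StepUp u v ∨ ClosesUp u v) ∨ (StepUp v u ∨ ClosesUp v u)) :=
  SimpleGraph.fromRel_adj _ u v

theorem necklace_adj_of_stepUp {u v : NecklaceVertex r D} (h : StepUp u v) :
    (necklace r D).Adj u v :=
  necklace_adj.2 ⟨fun huv => by simpa [huv] using h.1, .inl (.inl h)⟩

theorem index_eq_zero_of_odd_of_adj {u v : NecklaceVertex r D} (hu : Odd u.column)
    (h : (necklace r D).Adj u v) : v.index = 0 ∧
      (v.column = u.column + 1 ∨ u.column = v.column + 1) ∧
      (v.column = 0 ∨ v.strand = u.strand) := by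
  have := v.index_eq_zero
  simp only [necklace_adj, StepUp, ClosesUp, Nat.odd_iff, Nat.even_iff] at *
  omega

theorem NecklaceVertex.Twins.eq_of_adj {u w v a b : NecklaceVertex r D} (huw : Twins u w)
    (huv : (necklace r D).Adj u v) (hwv : (necklace r D).Adj w v) (hua : (necklace r D).Adj u a)
    (hwb : (necklace r D).Adj w b) (hav : a ≠ v) (hbv : b ≠ v) : a = b := by
  obtain ⟨hu, column_eq, strand_eq⟩ := huw
  have hw := column_eq ▸ hu
  have := index_eq_zero_of_odd_of_adj hu huv
  have := index_eq_zero_of_odd_of_adj hw hwv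
  have := index_eq_zero_of_odd_of_adj hu hua
  have := index_eq_zero_of_odd_of_adj hw hwb
  have := v.strand_eq_zero
  have := a.strand_eq_zero
  have := b.strand_eq_zero
  simp only [NecklaceVertex.ext_iff, ne_eq] at *
  omega

theorem column_eq_add_one_of_adj {u v w : NecklaceVertex r D} (huv : (necklace r D).Adj u v)
    (hvw : (necklace r D).Adj v w) (huw : u ≠ w) (not_twins : ¬ Twins u w) (hv : v.column ≠ 0)
    (hu : u.column = v.column + 1 ∨ v.column = 2 * r ∧ u.column = 0) :
    v.column = w.column + 1 := by
  have := u.index_eq_zero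
  have := u.strand_eq_zero
  have := u.column_le
  have := w.index_eq_zero
  have := w.strand_eq_zero
  have := w.column_le
  simp only [necklace_adj, StepUp, ClosesUp, Twins, NecklaceVertex.ext_iff, ne_eq] at *
  grind

theorem twins_or_column_eq_zero_of_adj {u v w : NecklaceVertex r D}
    (huv : (necklace r D).Adj u v) (hvw : (necklace r D).Adj v w) (huw : u ≠ w)
    (hu : u.column ≤ v.column) (hw : w.column ≤ v.column) :
    Twins u w ∨ v.column = 2 * r ∧ (u.column = 0 ∨ w.column = 0) := by
  have := u.index_eq_zero
  have := u.strand_eq_zero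
  have := w.index_eq_zero
  have := w.strand_eq_zero
  simp only [necklace_adj, StepUp, ClosesUp, Twins, NecklaceVertex.ext_iff, ne_eq] at *
  grind

theorem exists_zmod_of_cycleGraph_isContained {V : Type*} {G : SimpleGraph V} {k : ℕ} (hk : 2 ≤ k)
    (h : (SimpleGraph.cycleGraph k).IsContained G) :
    ∃ f : ZMod k → V, Function.Injective f ∧ ∀ i, G.Adj (f i) (f (i + 1)) := by
  obtain ⟨φ⟩ := h
  obtain ⟨n, rfl⟩ := Nat.exists_eq_add_of_le' hk
  exact ⟨φ, φ.injective, fun i => φ.toHom.map_adj <|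
    SimpleGraph.cycleGraph_adj.2 (.inr (add_sub_cancel_left (a := (i : ZMod (n + 2))) 1))⟩

theorem zmod_sub_one_ne_add_one {k : ℕ} (hk : 3 ≤ k) (i : ZMod k) : i - 1 ≠ i + 1 := fun h => by
  have two : ((2 : ℕ) : ZMod k) = 0 := by linear_combination -h
  have := Nat.le_of_dvd two_pos ((ZMod.natCast_eq_zero_iff _ _).1 two)
  omega

section Cycle

variable {k : ℕ} (hk : 3 ≤ k) {f : ZMod k → NecklaceVertex r D} (hf : Function.Injective f)
  (adj : ∀ i, (necklace r D).Adj (f i) (f (i + 1)))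

include hk hf adj

theorem eq_four_of_twins {i : ZMod k} (h : Twins (f (i - 1)) (f (i + 1))) : k = 4 := by
  have eq : f (i - 1 - 1) = f (i + 1 + 1) := by
    refine h.eq_of_adj (v := f i) ?_ (adj i).symm ?_ (adj _) (hf.ne ?_) (hf.ne ?_)
    · simpa using adj (i - 1)
    · simpa using (adj (i - 1 - 1)).symm
    · simpa using zmod_sub_one_ne_add_one hk (i - 1)
    · simpa using (zmod_sub_one_ne_add_one hk (i + 1)).symm
  have dvd : k ∣ 4 := by
    rw [← ZMod.natCast_eq_zero_iff]
    push_cast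
    linear_combination -hf eq
  have := Nat.le_of_dvd four_pos dvd
  interval_cases k <;> omega

theorem eq_two_mul_add_one_of_column_eq_zero (hk4 : k ≠ 4) {i : ZMod k}
    (last : (f i).column = 2 * r) (root : (f (i - 1)).column = 0) : k = 2 * r + 1 := by
  have descent (s : ℕ) (hs : s ≤ 2 * r) : (f (i + s)).column = 2 * r - s ∧
      ((f (i + s - 1)).column = (f (i + s)).column + 1 ∨
        (f (i + s)).column = 2 * r ∧ (f (i + s - 1)).column = 0) := by
    induction s with
    | zero => simp [last, root]
    | succ s ih =>
      obtain ⟨column_eq, previous⟩ := ih (by omega)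
      have step := column_eq_add_one_of_adj (by simpa using adj (i + s - 1)) (adj (i + s))
        (hf.ne (zmod_sub_one_ne_add_one hk _)) (fun h => hk4 (eq_four_of_twins hk hf adj h))
        (by omega) previous
      push_cast
      rw [← add_assoc, add_sub_cancel_right]
      omega
  have dvd : k ∣ 2 * r + 1 := by
    have eq := (eq_root ((descent _ le_rfl).1.trans (Nat.sub_self _))).trans (eq_root root).symm
    rw [← ZMod.natCast_eq_zero_iff]
    push_cast at eq ⊢
    linear_combination hf eq
  refine (Nat.le_of_dvd (by omega) dvd).antisymm (not_lt.1 fun hlt => ?_)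
  have := (descent k (by omega)).1
  rw [ZMod.natCast_self, add_zero] at this
  omega

end Cycle

theorem eq_four_or_eq_of_cycleGraph_isContained_necklace {k : ℕ} (hk : 3 ≤ k)
    (h : (SimpleGraph.cycleGraph k).IsContained (necklace r D)) : k = 4 ∨ k = 2 * r + 1 := by
  obtain ⟨f, hf, adj⟩ := exists_zmod_of_cycleGraph_isContained (by omega) h
  refine or_iff_not_imp_left.2 fun hk4 => ?_
  have : NeZero k := ⟨by omega⟩
  obtain ⟨i, hi⟩ := Finite.exists_max fun i => (f i).column
  obtain twins | ⟨last, root | root⟩ := twins_or_column_eq_zero_of_adj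
    (by simpa using adj (i - 1)) (adj i) (hf.ne (zmod_sub_one_ne_add_one hk i)) (hi _) (hi _)
  · exact absurd (eq_four_of_twins hk hf adj twins) hk4
  · exact eq_two_mul_add_one_of_column_eq_zero hk hf adj hk4 last root
  · refine eq_two_mul_add_one_of_column_eq_zero (f := fun i => f (-i)) (i := -i) hk
      (hf.comp neg_injective) (fun i => ?_) hk4 (by simpa using last) ?_
    · simpa [add_comm] using (adj (-(i + 1))).symm
    · simpa [add_comm] using root

theorem HasDefect.card_le {V α : Type*} [Finite V] {G : SimpleGraph V} {c : V → α} {d : ℕ}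
    (h : HasDefect G c d) {v : V} {s : Finset V} (hs : ∀ w ∈ s, G.Adj v w ∧ c w = c v) :
    #s ≤ d := by
  rw [← Set.ncard_coe_finset]
  exact (Set.ncard_le_ncard hs (Set.toFinite _)).trans (h v)

theorem HasDefect.eq_of_two_mul_lt_card {V : Type*} [Finite V] {G : SimpleGraph V} {c : V → Fin 2}
    {d : ℕ} (h : HasDefect G c d) {x y : V} {s : Finset V} (card : 2 * d < #s)
    (hs : ∀ w ∈ s, G.Adj x w ∧ G.Adj y w) : c x = c y := by
  by_contra hne
  have hx : #{w ∈ s | c w = c x} ≤ d := h.card_le (v := x) <| by grind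
  have hy : #{w ∈ s | ¬ c w = c x} ≤ d := h.card_le (v := y) <| by grind
  have := s.card_filter_add_card_filter_not (fun w => c w = c x)
  omega

namespace NecklaceVertex

variable {t j m : ℕ}

/-- The bead of strand `j` in column `2 * t`, which is the root for `t = 0`. -/
def bead (ht : t ≤ r) (hj : j ≤ D) : NecklaceVertex r D :=
  ⟨2 * t, if t = 0 then 0 else j, 0, by omega, by split <;> omega, by omega, fun _ => rfl, by grind⟩

/-- The link with index `m` of strand `j` in column `2 * t + 1`. -/
def link (ht : t < r) (hj : j ≤ D) (hm : m ≤ 2 * D) : NecklaceVertex r D :=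
  ⟨2 * t + 1, j, m, by omega, hj, hm, by grind, by omega⟩

theorem stepUp_bead_link (ht : t < r) (hj : j ≤ D) (hm : m ≤ 2 * D) :
    StepUp (bead ht.le hj) (link ht hj hm) := by
  grind [StepUp, bead, link]

theorem stepUp_link_bead (ht : t < r) (hj : j ≤ D) (hm : m ≤ 2 * D) :
    StepUp (link ht hj hm) (bead (Nat.succ_le_of_lt ht) hj) := by
  grind [StepUp, bead, link]

end NecklaceVertex

theorem HasDefect.bead_eq_root {c : NecklaceVertex r D → Fin 2} (h : HasDefect (necklace r D) c D)
    {j : ℕ} (hj : j ≤ D) {t : ℕ} (ht : t ≤ r) : c (bead ht hj) = c root := by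
  induction t with
  | zero => congr
  | succ t ih =>
    let links : Finset (NecklaceVertex r D) := univ.map
      ⟨fun m : Fin (2 * D + 1) => link ht hj m.is_le, fun m n hmn => by
        simpa [link, Fin.ext_iff] using hmn⟩
    rw [← ih (Nat.le_of_succ_le ht)]
    refine h.eq_of_two_mul_lt_card (s := links) (by simp [links]) fun w hw => ?_
    obtain ⟨m, -, rfl⟩ := mem_map.1 hw
    exact ⟨(necklace_adj_of_stepUp (stepUp_link_bead ht hj m.is_le)).symm,
      necklace_adj_of_stepUp (stepUp_bead_link ht hj m.is_le)⟩

theorem not_hasDefect_necklace (hr : 0 < r) (c : NecklaceVertex r D → Fin 2) :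
    ¬ HasDefect (necklace r D) c D := by
  intro h
  let lastBeads : Finset (NecklaceVertex r D) := univ.map
    ⟨fun j : Fin (D + 1) => bead le_rfl j.is_le, fun i j hij => by
      simpa [bead, hr.ne', Fin.ext_iff] using hij⟩
  have card_le : #lastBeads ≤ D := h.card_le (v := root) fun w hw => by
    obtain ⟨j, -, rfl⟩ := mem_map.1 hw
    refine ⟨necklace_adj.2 ⟨?_, .inl (.inr ⟨rfl, rfl⟩)⟩, h.bead_eq_root j.is_le le_rfl⟩
    simp [root, bead, hr.ne']
  simp [lastBeads] at card_le

end Necklace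

/-! ### Straight-line drawings -/

section StraightEdge

variable {V : Type} {p : V → Plane}

/-- The segment that represents an edge when the vertices are placed at the points `p v`. -/
def straightEdge (p : V → Plane) : Sym2 V → Set Plane :=
  Sym2.lift ⟨fun u v => segment ℝ (p u) (p v), fun _ _ => segment_symm ℝ _ _⟩

theorem mem_straightEdge {u v : V} {z : Plane} : z ∈ straightEdge p s(u, v) ↔
    ∃ θ ∈ Set.Icc (0 : ℝ) 1, (1 - θ) • p u + θ • p v = z := by
  rw [straightEdge, Sym2.lift_mk, Subtype.coe_mk, segment_eq_image]
  rfl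

theorem isPolygonalArc_segment {x y : Plane} (hxy : x ≠ y) :
    IsPolygonalArc (segment ℝ x y) x y :=
  ⟨0, fun i => if i = 0 then x else y, by simp, by simp, by simp, by simpa using hxy, by simp,
    by omega⟩

theorem isPlanar_of_straightEdge {G : SimpleGraph V} (hp : Function.Injective p)
    (mem_of_mem : ∀ e ∈ G.edgeSet, ∀ w, p w ∈ straightEdge p e → w ∈ e)
    (meet : ∀ e ∈ G.edgeSet, ∀ f ∈ G.edgeSet, e ≠ f → ∀ z ∈ straightEdge p e,
      z ∈ straightEdge p f → ∃ w ∈ e, p w = z) : IsPlanar G :=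
  ⟨{  point := p
      point_injective := hp
      arc := straightEdge p
      isPolygonalArc := fun u v h => isPolygonalArc_segment (hp.ne h.ne)
      interior_disjoint_vertices := fun e he => by
        rw [Set.disjoint_left]
        rintro _ ⟨hw, h_end⟩ ⟨w, rfl⟩
        exact h_end ⟨w, mem_of_mem e he w hw, rfl⟩
      interior_disjoint_edges := fun e he f hf hef => by
        rw [Set.disjoint_left]
        rintro z ⟨hz, h_end⟩ hz'
        exact h_end (meet e he f hf hef z hz hz') }⟩

end StraightEdge

section NecklaceDrawing

variable {r D : ℕ} {u v w u' v' : NecklaceVertex r D} {z : Plane}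

namespace NecklaceVertex

/-- The slope of the line from the root to `v` in the drawing of the necklace. Strand `j` is drawn
between the slopes `j * (2 * D + 2)` and `(j + 1) * (2 * D + 2)`; the former is the slope of its
closing edge. -/
def slope (v : NecklaceVertex r D) : ℕ :=
  v.strand * (2 * D + 2) + if v.column = 2 * r then 0 else v.index + 1

/-- The second coordinate of `v` in the drawing of the necklace. -/
def height (v : NecklaceVertex r D) : ℕ :=
  v.column * v.slope

/-- The place of `v` in the drawing of the necklace. -/
def point (v : NecklaceVertex r D) : Plane :=
  (v.column, v.height)

theorem slope_lt_of_strand_lt (h : u.strand < v.strand) : u.slope < v.slope := by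
  have := u.index_le
  calc u.slope < (u.strand + 1) * (2 * D + 2) := by
        rw [slope, add_one_mul]
        split <;> omega
    _ ≤ v.strand * (2 * D + 2) := Nat.mul_le_mul_right _ h
    _ ≤ v.slope := Nat.le_add_right _ _

theorem strand_eq_of_slope_eq (h : u.slope = v.slope) : u.strand = v.strand := by
  by_contra hne
  obtain hlt | hlt := lt_or_gt_of_ne hne <;> have := slope_lt_of_strand_lt hlt <;> omega

theorem eq_of_slope_eq (column_eq : u.column = v.column) (slope_eq : u.slope = v.slope) :
    u = v := by
  have strand_eq := strand_eq_of_slope_eq slope_eq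
  have := u.index_eq_zero
  have := v.index_eq_zero
  rw [slope, slope, strand_eq, column_eq, Nat.add_left_cancel_iff] at slope_eq
  exact NecklaceVertex.ext column_eq strand_eq (by grind)

theorem eq_of_slope_eq_last (hv : v.column = 2 * r) (slope_eq : u.slope = v.slope) : u = v := by
  refine eq_of_slope_eq ?_ slope_eq
  rw [slope, slope, strand_eq_of_slope_eq slope_eq, if_pos hv, Nat.add_left_cancel_iff] at slope_eq
  grind

theorem last_slope_le (hv : v.column = 2 * r) (h : v.strand ≤ u.strand) : v.slope ≤ u.slope := by
  rw [slope, slope, if_pos hv]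
  exact Nat.add_le_add (Nat.mul_le_mul_right _ h) (Nat.zero_le _)

theorem eq_of_height_eq (column_eq : u.column = v.column) (height_eq : u.height = v.height) :
    u = v := by
  obtain h | h := eq_or_ne v.column 0
  · rw [eq_root h, eq_root (column_eq.trans h)]
  · rw [height, height, column_eq] at height_eq
    exact eq_of_slope_eq column_eq (Nat.eq_of_mul_eq_mul_left (Nat.pos_of_ne_zero h) height_eq)

theorem point_injective : Function.Injective (point : NecklaceVertex r D → Plane) := by
  intro u v h
  simp only [point, Prod.mk.injEq, Nat.cast_inj] at h
  exact eq_of_height_eq h.1 h.2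

end NecklaceVertex

open NecklaceVertex

theorem exists_eq_of_mem_edgeSet_necklace {e : Sym2 (NecklaceVertex r D)}
    (he : e ∈ (necklace r D).edgeSet) : ∃ u v, e = s(u, v) ∧ (StepUp u v ∨ ClosesUp u v) := by
  induction e with | h u v
  obtain ⟨-, h | h⟩ := necklace_adj.1 he
  exacts [⟨u, v, rfl, h⟩, ⟨v, u, Sym2.eq_swap, h⟩]

theorem NecklaceVertex.StepUp.exists_eq (h : StepUp u v)
    (hz : z ∈ straightEdge point s(u, v)) : ∃ θ ∈ Set.Icc (0 : ℝ) 1,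
      z = (u.column + θ, (1 - θ) * u.height + θ * v.height) := by
  obtain ⟨θ, hθ, rfl⟩ := mem_straightEdge.1 hz
  refine ⟨θ, hθ, ?_⟩
  simp only [point, h.1, Prod.smul_mk, Prod.mk_add_mk, smul_eq_mul, Prod.mk.injEq, and_true]
  push_cast
  ring

theorem NecklaceVertex.ClosesUp.snd_eq (h : ClosesUp u v)
    (hz : z ∈ straightEdge point s(u, v)) : z.2 = z.1 * v.slope := by
  obtain ⟨θ, -, rfl⟩ := mem_straightEdge.1 hz
  simp only [point, height, h.1, Prod.smul_mk, Prod.mk_add_mk, smul_eq_mul]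
  push_cast
  ring

theorem NecklaceVertex.StepUp.mem_of_point_mem (h : StepUp u v)
    (hw : point w ∈ straightEdge point s(u, v)) : w ∈ s(u, v) := by
  obtain ⟨θ, ⟨h0, h1⟩, hz⟩ := h.exists_eq hw
  obtain ⟨column_eq, height_eq⟩ := Prod.mk.injEq .. ▸ hz
  have lower : u.column ≤ w.column := by
    rw [← Nat.cast_le (α := ℝ)]
    linarith
  have upper : w.column ≤ u.column + 1 := by
    rw [← Nat.cast_le (α := ℝ)]
    push_cast
    linarith
  obtain column_w | column_w : w.column = u.column ∨ w.column = v.column := by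
    have := h.1
    omega
  · obtain rfl : θ = 0 := by simpa [column_w] using column_eq
    exact Sym2.mem_iff.2 (.inl (eq_of_height_eq column_w (by simpa using height_eq)))
  · obtain rfl : θ = 1 := by simpa [column_w, h.1] using column_eq.symm
    exact Sym2.mem_iff.2 (.inr (eq_of_height_eq column_w (by simpa using height_eq)))

theorem NecklaceVertex.ClosesUp.mem_of_point_mem (h : ClosesUp u v)
    (hw : point w ∈ straightEdge point s(u, v)) : w ∈ s(u, v) := by
  have height_eq : (w.column * w.slope : ℕ) = (w.column : ℝ) * v.slope := h.snd_eq hw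
  obtain slope_eq | column_eq := mul_eq_mul_left_iff.1 (mod_cast height_eq)
  · exact Sym2.mem_iff.2 (.inr (eq_of_slope_eq_last h.2 slope_eq))
  · exact Sym2.mem_iff.2 (.inl ((eq_root column_eq).trans (eq_root h.1).symm))

theorem eq_and_eq_of_convexCombination_eq {θ a b a' b' : ℝ} (hθ : θ ∈ Set.Icc (0 : ℝ) 1)
    (ordered : a ≤ a' ∧ b ≤ b' ∨ a' ≤ a ∧ b' ≤ b)
    (eq : (1 - θ) * a + θ * b = (1 - θ) * a' + θ * b') :
    (θ = 1 ∨ a = a') ∧ (θ = 0 ∨ b = b') := by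
  wlog h : a ≤ a' ∧ b ≤ b' generalizing a b a' b'
  · obtain ⟨ha, hb⟩ := this ordered.symm eq.symm (ordered.resolve_left h)
    exact ⟨ha.imp_right Eq.symm, hb.imp_right Eq.symm⟩
  have ha := mul_nonneg (sub_nonneg.2 hθ.2) (sub_nonneg.2 h.1)
  have hb := mul_nonneg hθ.1 (sub_nonneg.2 h.2)
  have ha' : (1 - θ) * (a' - a) = 0 := by linarith
  have hb' : θ * (b' - b) = 0 := by linarith
  refine ⟨(mul_eq_zero.1 ha').imp ?_ ?_, (mul_eq_zero.1 hb').imp_right ?_⟩ <;> intros <;> linarith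

theorem NecklaceVertex.StepUp.heights_ordered (h : StepUp u v) (h' : StepUp u' v')
    (column_eq : u.column = u'.column) : u.height ≤ u'.height ∧ v.height ≤ v'.height ∨
      u'.height ≤ u.height ∧ v'.height ≤ v.height := by
  wlog hle : v.strand ≤ v'.strand generalizing u v u' v'
  · exact (this h' h column_eq.symm (le_of_not_ge hle)).symm
  obtain hlt | strand_eq := hle.lt_or_eq
  · refine .inl ⟨?_, ?_⟩
    · rw [height, height, column_eq]
      obtain h0 | strand_u' := h'.2
      · simp [h0]
      · have := u.strand_eq_zero
        have strand_lt : u.strand < u'.strand := by grind [h.2]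
        exact Nat.mul_le_mul_left _ (slope_lt_of_strand_lt strand_lt).le
    · rw [height, height, h.1, h'.1, column_eq]
      exact Nat.mul_le_mul_left _ (slope_lt_of_strand_lt hlt).le
  · obtain rfl | rfl : u = u' ∨ v = v' := by
      have := u.index_eq_zero
      have := u.strand_eq_zero
      have := u'.index_eq_zero
      have := u'.strand_eq_zero
      have := v.index_eq_zero
      have := v'.index_eq_zero
      simp only [StepUp, NecklaceVertex.ext_iff, Nat.even_iff] at *
      omega
    · simpa using le_total _ _
    · simpa using le_total _ _

theorem NecklaceVertex.StepUp.exists_of_mem_of_column_eq (h : StepUp u v) (h' : StepUp u' v')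
    (column_eq : u.column = u'.column) (hne : s(u, v) ≠ s(u', v'))
    (hz : z ∈ straightEdge point s(u, v)) (hz' : z ∈ straightEdge point s(u', v')) :
    ∃ w ∈ s(u, v), w ∈ s(u', v') ∧ point w = z := by
  obtain ⟨θ, hθ, rfl⟩ := h.exists_eq hz
  obtain ⟨θ', -, eq⟩ := h'.exists_eq hz'
  obtain ⟨rfl, height_eq⟩ : θ = θ' ∧ _ := by simpa [column_eq] using eq
  have ordered := h.heights_ordered h' column_eq
  have column_eq' : v.column = v'.column := by rw [h.1, h'.1, column_eq]
  have cases := eq_and_eq_of_convexCombination_eq hθ (mod_cast ordered) height_eq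
  simp only [Nat.cast_inj] at cases
  obtain ⟨rfl | hu, hv⟩ := cases
  · obtain rfl : v = v' := eq_of_height_eq column_eq' (hv.resolve_left one_ne_zero)
    exact ⟨v, Sym2.mem_mk_right _ _, Sym2.mem_mk_right _ _, by simp [point, h.1]⟩
  obtain rfl : u = u' := eq_of_height_eq column_eq hu
  obtain rfl | hv := hv
  · exact ⟨u, Sym2.mem_mk_left _ _, Sym2.mem_mk_left _ _, by simp [point]⟩
  · exact absurd (by rw [eq_of_height_eq column_eq' hv]) hne

theorem NecklaceVertex.StepUp.exists_of_mem_of_column_lt (h : StepUp u v) (h' : StepUp u' v')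
    (hlt : u.column < u'.column) (hz : z ∈ straightEdge point s(u, v))
    (hz' : z ∈ straightEdge point s(u', v')) : ∃ w ∈ s(u, v), w ∈ s(u', v') ∧ point w = z := by
  obtain ⟨θ, ⟨-, hθ⟩, rfl⟩ := h.exists_eq hz
  obtain ⟨θ', ⟨hθ', -⟩, eq⟩ := h'.exists_eq hz'
  obtain ⟨fst_eq, snd_eq⟩ := Prod.mk.injEq .. ▸ eq
  have hlt : (u.column + 1 : ℝ) ≤ u'.column := mod_cast hlt
  obtain rfl : θ = 1 := le_antisymm hθ (by linarith)
  obtain rfl : θ' = 0 := by linarith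
  have point_v : point v = ((u.column + 1 : ℝ), (1 - 1) * (u.height : ℝ) + 1 * v.height) := by
    simp [point, h.1]
  have point_u' : point u' = point v := by
    rw [point_v, eq]
    simp [point]
  obtain rfl := point_injective point_u'
  exact ⟨u', Sym2.mem_mk_right _ _, Sym2.mem_mk_left _ _, point_v⟩

theorem NecklaceVertex.StepUp.heights_ordered_of_last (h : StepUp u v) (hw : w.column = 2 * r) :
    u.height ≤ u.column * w.slope ∧ v.height ≤ v.column * w.slope ∨
      u.column * w.slope ≤ u.height ∧ v.column * w.slope ≤ v.height := by
  rw [height, height]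
  refine (lt_or_ge v.strand w.strand).imp (fun hlt => ⟨?_, ?_⟩) fun hge => ⟨?_, ?_⟩
  · obtain h0 | strand_u := h.2
    · simp [h0]
    · exact Nat.mul_le_mul_left _ (slope_lt_of_strand_lt (strand_u ▸ hlt)).le
  · exact Nat.mul_le_mul_left _ (slope_lt_of_strand_lt hlt).le
  · obtain h0 | strand_u := h.2
    · simp [h0]
    · exact Nat.mul_le_mul_left _ (last_slope_le hw (strand_u ▸ hge))
  · exact Nat.mul_le_mul_left _ (last_slope_le hw hge)

theorem NecklaceVertex.StepUp.exists_of_mem_of_closesUp (h : StepUp u v) (h' : ClosesUp u' v')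
    (hne : s(u, v) ≠ s(u', v')) (hz : z ∈ straightEdge point s(u, v))
    (hz' : z ∈ straightEdge point s(u', v')) : ∃ w ∈ s(u, v), w ∈ s(u', v') ∧ point w = z := by
  have snd_eq := h'.snd_eq hz'
  obtain ⟨θ, hθ, rfl⟩ := h.exists_eq hz
  have ordered := h.heights_ordered_of_last h'.2
  have cases := eq_and_eq_of_convexCombination_eq (a := u.height) (b := v.height)
    (a' := (u.column * v'.slope : ℕ)) (b' := (v.column * v'.slope : ℕ)) hθ (mod_cast ordered) <| by
      push_cast [h.1]
      linear_combination snd_eq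
  simp only [height, Nat.cast_inj, mul_eq_mul_left_iff] at cases
  have slope_u : u.slope ≠ v'.slope := fun hu => by
    have := h.1
    have := v.column_le
    have := h'.2
    have := eq_of_slope_eq_last h'.2 hu
    grind
  have column_v : v.column ≠ 0 := by simp [h.1]
  simp only [slope_u, column_v, false_or, or_false] at cases
  obtain ⟨rfl | hu, hv⟩ := cases
  · obtain rfl := eq_of_slope_eq_last h'.2 (hv.resolve_left one_ne_zero)
    exact ⟨v, Sym2.mem_mk_right _ _, Sym2.mem_mk_right _ _, by simp [point, h.1]⟩
  obtain rfl : u = u' := (eq_root hu).trans (eq_root h'.1).symm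
  obtain rfl | hv := hv
  · exact ⟨u, Sym2.mem_mk_left _ _, Sym2.mem_mk_left _ _, by simp [point]⟩
  · exact absurd (by rw [eq_of_slope_eq_last h'.2 hv]) hne

theorem NecklaceVertex.ClosesUp.exists_of_mem_of_closesUp (h : ClosesUp u v) (h' : ClosesUp u' v')
    (hne : s(u, v) ≠ s(u', v')) (hz : z ∈ straightEdge point s(u, v))
    (hz' : z ∈ straightEdge point s(u', v')) : ∃ w ∈ s(u, v), w ∈ s(u', v') ∧ point w = z := by
  obtain rfl : u = u' := (eq_root h.1).trans (eq_root h'.1).symm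
  have eq : z.1 * v.slope = z.1 * v'.slope := (h.snd_eq hz).symm.trans (h'.snd_eq hz')
  obtain slope_eq | fst_eq := mul_eq_mul_left_iff.1 eq
  · exact absurd (by rw [eq_of_slope_eq (h.2.trans h'.2.symm) (mod_cast slope_eq)]) hne
  · refine ⟨u, Sym2.mem_mk_left _ _, Sym2.mem_mk_left _ _, Prod.ext ?_ ?_⟩
    · simp [point, h.1, fst_eq]
    · simp [point, height, h.1, h.snd_eq hz, fst_eq]

theorem isPlanar_necklace (r D : ℕ) : IsPlanar (necklace r D) := by
  refine isPlanar_of_straightEdge point_injective (fun e he w hw => ?_)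
    fun e he f hf hef z hz hz' => ?_
  · obtain ⟨u, v, rfl, h | h⟩ := exists_eq_of_mem_edgeSet_necklace he
    exacts [h.mem_of_point_mem hw, h.mem_of_point_mem hw]
  · suffices ∃ w ∈ e, w ∈ f ∧ point w = z from this.imp fun w hw => ⟨hw.1, hw.2.2⟩
    obtain ⟨u, v, rfl, h⟩ := exists_eq_of_mem_edgeSet_necklace he
    obtain ⟨u', v', rfl, h'⟩ := exists_eq_of_mem_edgeSet_necklace hf
    obtain h | h := h <;> obtain h' | h' := h'
    · obtain hlt | eq | hlt := lt_trichotomy u.column u'.column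
      · exact h.exists_of_mem_of_column_lt h' hlt hz hz'
      · exact h.exists_of_mem_of_column_eq h' eq hef hz hz'
      · simpa only [and_left_comm] using h'.exists_of_mem_of_column_lt h hlt hz' hz
    · exact h.exists_of_mem_of_closesUp h' hef hz hz'
    · simpa only [and_left_comm] using h'.exists_of_mem_of_closesUp h hef.symm hz' hz
    · exact h.exists_of_mem_of_closesUp h' hef hz hz'

end NecklaceDrawing

/-! ### The characterization -/

theorem isBalancedObstructionSet_iff (S : Set CycleLength) :
    IsBalancedObstructionSet 2 S ↔ fourCycle ∈ S ∨ oddCycles ⊆ S := by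
  refine ⟨fun ⟨D, colorable⟩ => ?_, fun h => h.elim isBalancedObstructionSet_of_fourCycle_mem
    isBalancedObstructionSet_of_oddCycles_subset⟩
  by_contra! ⟨four_notMem, not_subset⟩
  obtain ⟨⟨k, hk⟩, ⟨r, hkr⟩, k_notMem⟩ := Set.not_subset.1 not_subset
  have avoids : ∀ l ∈ S, ¬ (SimpleGraph.cycleGraph l.1).IsContained (necklace r D) := by
    intro l hl contained
    obtain h | h := eq_four_or_eq_of_cycleGraph_isContained_necklace l.2 contained
    · exact four_notMem ((Subtype.ext h : l = fourCycle) ▸ hl)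
    · exact k_notMem ((Subtype.ext (h.trans hkr.symm) : l = ⟨k, hk⟩) ▸ hl)
  obtain ⟨c, hc⟩ := isDefectiveColorable_iff.1
    (colorable _ (necklace r D) ⟨isPlanar_necklace r D, avoids⟩)
  exact not_hasDefect_necklace (by dsimp only at hkr; omega) c hc

theorem fourCycle_notMem_oddCycles : fourCycle ∉ oddCycles :=
  Nat.not_odd_iff_even.2 (by decide : Even 4)

theorem not_oddCycles_subset_singleton : ¬ oddCycles ⊆ {fourCycle} := by
  intro h
  have three_mem : (⟨3, le_rfl⟩ : CycleLength) ∈ oddCycles := (by decide : Odd 3)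
  exact absurd (Subtype.ext_iff.1 (h three_mem)) (by decide)

theorem minimal_le_or_le_iff {α : Type*} [PartialOrder α] {a b x : α} (hab : ¬ a ≤ b)
    (hba : ¬ b ≤ a) : Minimal (fun x => a ≤ x ∨ b ≤ x) x ↔ x = a ∨ x = b := by
  constructor
  · rintro ⟨ha | hb, hx⟩
    · exact .inl ((hx (.inl le_rfl) ha).antisymm ha)
    · exact .inr ((hx (.inr le_rfl) hb).antisymm hb)
  · rintro (rfl | rfl)
    · exact ⟨.inl le_rfl, fun y hy hyx => hy.elim id fun hby => absurd (hby.trans hyx) hba⟩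
    · exact ⟨.inr le_rfl, fun y hy hyx => hy.elim (fun hay => absurd (hay.trans hyx) hab) id⟩

end ImproperColoring

open ImproperColoring in
theorem mainTheorem1 :
    (∀ S : Set CycleLength,
      IsBalancedObstructionSet 2 S ↔ fourCycle ∈ S ∨ oddCycles ⊆ S) ∧
    (∀ S : Set CycleLength,
      Minimal (IsBalancedObstructionSet 2) S ↔ S = {fourCycle} ∨ S = oddCycles) := by
  refine ⟨isBalancedObstructionSet_iff, fun S => ?_⟩
  have eq : IsBalancedObstructionSet 2 = fun S => {fourCycle} ≤ S ∨ oddCycles ≤ S := by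
    ext S
    exact (isBalancedObstructionSet_iff S).trans (or_congr_left Set.singleton_subset_iff.symm)
  rw [eq, minimal_le_or_le_iff]
  · exact fun h => fourCycle_notMem_oddCycles (Set.singleton_subset_iff.1 h)
  · exact not_oddCycles_subset_singleton
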